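/- A sequence $\mathbf v=v_0v_1v_2\cdots$ over a finite alphabet is balanced if for every letter $a$ and all factors $u,w$ of $\mathbf v$ with $|u|=|w|$ one has $|u|_a-|w|_a\le 1$, where $|u|_a$ is the number of occurrences of $a$ in $u$. The exponent of a nonempty word $z$ is $\exp(z)=|z|/p$, where $p$ is the length of the shortest nonempty word $u$ such that $z$ is a prefix of the periodic sequence $u^\omega=uuu\cdots$. The critical exponent of $\mathbf v$ is $\mathrm E(\mathbf v)=\sup\{\exp(z): z \text{ is a nonempty factor of } \mathbf v\}\in\mathbb R\cup\{+\infty\}$. **Theorem.** For each integer $d\ge 11$, there is no balanced sequence $\mathbf v$ over an alphabet with $d$ letters such that $\mathrm E(\mathbf v)<\frac{d-1}{d-2}$. -/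

import Mathlib

namespace WordSeq

variable {A : Type*}

/-- The word `v i, v (i+1), …, v (i+n-1)` of length `n` occurring at position `i` of the
sequence `v`. -/
def factorAt (v : ℕ → A) (i n : ℕ) : List A :=
  (List.range n).map (fun k => v (i + k))

/-- The language of `v`: the set of all its factors (the empty word included). -/
def language (v : ℕ → A) : Set (List A) :=
  {z | ∃ i n : ℕ, z = factorAt v i n}

/-- `v` is balanced: for every letter `a` and all factors `u`, `w` of `v` of the same length,
`|u|_a - |w|_a ≤ 1`. -/
def IsBalanced [DecidableEq A] (v : ℕ → A) : Prop :=
  ∀ a : A, ∀ u ∈ language v, ∀ w ∈ language v, u.length = w.length →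
    (u.count a : ℤ) - (w.count a : ℤ) ≤ 1

/-- The periodic sequence `u^ω = u u u ⋯` for a nonempty word `u`. -/
def omegaPower (u : List A) (hu : u ≠ []) : ℕ → A :=
  fun i => u[i % u.length]'(Nat.mod_lt i (List.length_pos_of_ne_nil hu))

/-- The (minimal) period of a word `z`: the length of the shortest nonempty word `u` such that
`z` is a prefix of `u^ω`. (For nonempty `z` such words exist, for instance `u = z`.) -/
noncomputable def minPeriod (z : List A) : ℕ :=
  sInf {p : ℕ | ∃ (u : List A) (hu : u ≠ []),
    u.length = p ∧ z = factorAt (omegaPower u hu) 0 z.length}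

/-- The exponent of a nonempty word: its length divided by its minimal period. -/
noncomputable def exponent (z : List A) : ℝ :=
  (z.length : ℝ) / (minPeriod z : ℝ)

/-- The critical exponent of `v`: the supremum, in the extended reals, of the exponents of the
nonempty factors of `v`. -/
noncomputable def criticalExponent (v : ℕ → A) : EReal :=
  ⨆ z ∈ {z : List A | z ∈ language v ∧ z ≠ []}, ((exponent z : ℝ) : EReal)

end WordSeq

namespace WordSeq

/-! ### Exponents and balance in terms of positions -/

section Factors

variable {A : Type*}

/-! The exponent bound makes any `d - 1` consecutive letters distinct, so up to finitely many
positions every return has length `d - 1`, `d` or `d + 1`. Cut into rows of length `d`, the sequence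
evolves by swaps: a short return at `j` exchanges the letters of positions `j`, `j + 1` in passing
to `j + d`, `j + d + 1`. Overlaps of length 2 with period `d - 1` or `d` being forbidden,
consecutive swaps are 2 or 3 apart; a gap of 3 leaves one medium return.

Balance forbids a letter to be both fast and slow (`IsBalanced.not_isSlow_of_isFast`). Hence a gap
of 2 forces the swap one row below, and a gap of 3 leaves two options, according as its medium
letter is fast or slow. Medium returns of fast letters move by `d + 1`, those of slow letters by `d
- 1`; if both existed they would collide (`IsBalanced.not_fast_and_slow`). So the swaps eventually
repeat with period `d + 1` or `d - 1`, which makes the sequence eventually periodic and its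
exponents unbounded. -/

theorem length_factorAt (v : ℕ → A) (i n : ℕ) : (factorAt v i n).length = n := by
  simp [factorAt]

theorem factorAt_eq_prefix_omegaPower {v : ℕ → A} {s p q : ℕ}
    (h : ∀ k < q, v (s + k + p) = v (s + k)) (hne : factorAt v s p ≠ []) :
    factorAt v s (p + q) = factorAt (omegaPower (factorAt v s p) hne) 0 (p + q) := by
  have hp : 0 < p := by
    have := List.length_pos_of_ne_nil hne
    rwa [length_factorAt] at this
  have key : ∀ k < p + q, v (s + k) = v (s + k % p) := by
    intro k
    induction k using Nat.strong_induction_on with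
    | _ k ih =>
      intro hk
      rcases lt_or_ge k p with hkp | hkp
      · rw [Nat.mod_eq_of_lt hkp]
      · have h1 := h (k - p) (by omega)
        rw [show s + (k - p) + p = s + k by omega] at h1
        rw [h1, ih (k - p) (by omega) (by omega), Nat.mod_eq_sub_mod hkp]
  refine List.map_congr_left fun k hk => ?_
  rw [List.mem_range] at hk
  rw [key k hk]
  simp [omegaPower, factorAt]

theorem le_exponent_factorAt {v : ℕ → A} {s p q : ℕ} (hp : 0 < p)
    (h : ∀ k < q, v (s + k + p) = v (s + k)) :
    ((p + q : ℕ) : ℝ) / p ≤ exponent (factorAt v s (p + q)) := by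
  have hne : factorAt v s p ≠ [] := by
    apply List.ne_nil_of_length_pos
    rwa [length_factorAt]
  have hmem : p ∈ {p' : ℕ | ∃ (u : List A) (hu : u ≠ []), u.length = p' ∧
      factorAt v s (p + q) = factorAt (omegaPower u hu) 0 (factorAt v s (p + q)).length} := by
    refine ⟨_, hne, length_factorAt _ _ _, ?_⟩
    rw [length_factorAt]
    exact factorAt_eq_prefix_omegaPower h hne
  have hle : minPeriod (factorAt v s (p + q)) ≤ p := Nat.sInf_le hmem
  have hpos : 0 < minPeriod (factorAt v s (p + q)) := by
    obtain ⟨u, hu, hl, -⟩ := Nat.sInf_mem ⟨p, hmem⟩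
    exact lt_of_lt_of_eq (List.length_pos_of_ne_nil hu) hl
  rw [exponent, length_factorAt]
  gcongr

/-- A repetition of period `p` and length `p + q` in a sequence of critical exponent less
than `(d - 1) / (d - 2)` satisfies `q / p < 1 / (d - 2)`. -/
theorem mul_lt_of_criticalExponent_lt {v : ℕ → A} {d : ℕ} (hd : 3 ≤ d)
    (hE : criticalExponent v < ((((d : ℝ) - 1) / ((d : ℝ) - 2) : ℝ) : EReal))
    {s p q : ℕ} (hp : 0 < p) (h : ∀ k < q, v (s + k + p) = v (s + k)) :
    q * (d - 2) < p := by
  have h1 : ((exponent (factorAt v s (p + q)) : ℝ) : EReal) ≤ criticalExponent v := by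
    refine le_iSup₂_of_le (f := fun (z : List A)
      (_ : z ∈ {z : List A | z ∈ language v ∧ z ≠ []}) => ((exponent z : ℝ) : EReal))
      (factorAt v s (p + q)) ⟨⟨s, p + q, rfl⟩, ?_⟩ le_rfl
    apply List.ne_nil_of_length_pos
    rw [length_factorAt]
    omega
  have h2 := (le_exponent_factorAt hp h).trans_lt (EReal.coe_lt_coe_iff.mp (h1.trans_lt hE))
  have hd' : (0 : ℝ) < (d : ℝ) - 2 := by
    have : (3 : ℝ) ≤ d := by exact_mod_cast hd
    linarith
  rw [div_lt_div_iff₀ (by exact_mod_cast hp) hd'] at h2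
  push_cast at h2
  have h3 : ((q * (d - 2) : ℕ) : ℝ) < p := by
    push_cast [Nat.cast_sub (show 2 ≤ d by omega)]
    nlinarith
  exact_mod_cast h3

/-- In a balanced sequence, a letter occurring at both ends of a factor of length `n ≥ 2`
occurs in every factor of length `n`. -/
theorem IsBalanced.exists_eq [DecidableEq A] {v : ℕ → A} (hv : IsBalanced v) {e i : ℕ}
    (h : v (i + (e + 1)) = v i) (j : ℕ) : ∃ k < e + 2, v (j + k) = v i := by
  by_contra! hc
  have h1 := hv (v i) _ ⟨i, e + 2, rfl⟩ _ ⟨j, e + 2, rfl⟩ (by simp [length_factorAt])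
  have h2 : (factorAt v j (e + 2)).count (v i) = 0 := by
    rw [List.count_eq_zero]
    simp only [factorAt, List.mem_map, List.mem_range, not_exists, not_and]
    exact hc
  have h3 : 2 ≤ (factorAt v i (e + 2)).count (v i) := by
    rw [factorAt, List.range_succ, List.range_succ_eq_map]
    simp [h, List.count_append]
  omega

end Factors

/-! ### Swaps, fast letters and slow letters -/

section Swaps

variable {A : Type*} {v : ℕ → A} {d : ℕ}

/-- The sequence `v` has no repetition of exponent at least `(d - 1) / (d - 2)`. -/
def AvoidsRepetitions (v : ℕ → A) (d : ℕ) : Prop :=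
  ∀ s p q : ℕ, 0 < p → (∀ k < q, v (s + k + p) = v (s + k)) → q * (d - 2) < p

/-- The letter at position `j + 1` reappears `d - 1` positions later. -/
def ShortReturn (v : ℕ → A) (d j : ℕ) : Prop := v (j + d) = v (j + 1)

theorem AvoidsRepetitions.ne (h : AvoidsRepetitions v d) {i j : ℕ} (hij : i < j)
    (hj : j ≤ i + (d - 2)) : v j ≠ v i := by
  intro he
  have := h i (j - i) 1 (by omega) (by
    intro k hk
    obtain rfl : k = 0 := by omega
    rw [show i + 0 + (j - i) = j by omega, he, add_zero])
  omega

theorem AvoidsRepetitions.not_shortReturn_succ (h : AvoidsRepetitions v d) (hd : 4 ≤ d)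
    {j : ℕ} (hj : ShortReturn v d j) : ¬ ShortReturn v d (j + 1) := by
  intro hj'
  have := h (j + 1) (d - 1) 2 (by omega) (by
    intro k hk
    interval_cases k
    · rw [show j + 1 + 0 + (d - 1) = j + d by omega]; exact hj
    · rw [show j + 1 + 1 + (d - 1) = j + 1 + d by omega]; exact hj')
  omega

/-- A letter having a return of length `d - 1`. -/
def IsFast (v : ℕ → A) (d : ℕ) (a : A) : Prop := ∃ j, 0 < j ∧ ShortReturn v d j ∧ v (j + 1) = a

/-- A letter having a return of length `d + 1`. -/
def IsSlow (v : ℕ → A) (d : ℕ) (a : A) : Prop := ∃ j, 0 < j ∧ ShortReturn v d j ∧ v j = a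

/-- By balance a fast letter occurs in every window of length `d`, whereas a slow one is missing
from the `d` positions inside its long return. -/
theorem IsBalanced.not_isSlow_of_isFast [DecidableEq A] (hv : IsBalanced v) (h : AvoidsRepetitions v d)
    (hd : 4 ≤ d) {a : A} (hf : IsFast v d a) : ¬ IsSlow v d a := by
  rintro ⟨j, hj0, hj, hja⟩
  obtain ⟨i, -, hi, hia⟩ := hf
  have hi' : v (i + 1 + (d - 2 + 1)) = v (i + 1) := by
    rw [show i + 1 + (d - 2 + 1) = i + d by omega]; exact hi
  obtain ⟨k, hk, hk'⟩ := hv.exists_eq hi' (j + 1)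
  rw [hia, ← hja] at hk'
  by_cases h1 : k = d - 1
  · rw [show j + 1 + k = j + d by omega, show v (j + d) = v (j + 1) from hj] at hk'
    exact h.ne (by omega) (by omega) hk'
  by_cases h2 : k = d - 2
  · obtain ⟨t, rfl⟩ : ∃ t, j = t + 1 := ⟨j - 1, by omega⟩
    rw [show t + 1 + 1 + k = t + d by omega] at hk'
    exact h.not_shortReturn_succ hd hk' hj
  exact h.ne (by omega) (by omega) hk'

/-! ### The swap positions determine the sequence -/

variable [Fintype A]

theorem AvoidsRepetitions.exists_eq (h : AvoidsRepetitions v d) (hd : 4 ≤ d)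
    (hA : Fintype.card A = d) {n : ℕ} (hn : ¬ ShortReturn v d n) (a : A) :
    ∃ k < d, v (n + 1 + k) = a := by
  have hne : ∀ i j : Fin d, i < j → v (n + 1 + j) ≠ v (n + 1 + i) := by
    intro i j hij
    have hi := i.2
    have hj := j.2
    have hij' : i.1 < j.1 := hij
    by_cases hc : j.1 ≤ i.1 + (d - 2)
    · exact h.ne (by omega) (by omega)
    · have h1 : i.1 = 0 := by omega
      have h2 : n + 1 + j.1 = n + d := by omega
      rw [h1, h2]
      exact hn
  have hinj : Function.Injective fun k : Fin d => v (n + 1 + k) := by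
    intro i j hij
    rcases lt_trichotomy i j with hlt | heq | hlt
    · exact absurd hij.symm (hne i j hlt)
    · exact heq
    · exact absurd hij (hne j i hlt)
  obtain ⟨k, hk⟩ := ((Fintype.bijective_iff_injective_and_card _).2
    ⟨hinj, by simp [hA]⟩).surjective a
  exact ⟨k, k.2, hk⟩

/-- The preceding window of length `d` contains all letters, and every candidate but its first is
excluded. This is the long return that accompanies a short one. -/
theorem AvoidsRepetitions.eq_of_shortReturn (h : AvoidsRepetitions v d) (hd : 4 ≤ d)
    (hA : Fintype.card A = d) {j : ℕ} (hj : ShortReturn v d (j + 1)) :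
    v (j + 1 + d + 1) = v (j + 1) := by
  have hpre : ¬ ShortReturn v d j := fun hc => h.not_shortReturn_succ hd hc hj
  have hnext : ¬ ShortReturn v d (j + 1 + 1) := h.not_shortReturn_succ hd hj
  obtain ⟨k, hk, hk'⟩ := h.exists_eq hd hA hpre (v (j + 1 + d + 1))
  rcases Nat.eq_zero_or_pos k with rfl | hk0
  · exact hk'.symm
  exfalso
  by_cases h1 : k = 1
  · subst h1
    have hj2 : v (j + 1 + d) = v (j + 1 + 1) := hj
    exact h.ne (i := j + 1 + d) (j := j + 1 + d + 1) (by omega) (by omega) (by rw [hj2, hk'])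
  by_cases h2 : k = 2
  · subst h2
    apply hnext
    have : v (j + 1 + 1 + d) = v (j + 1 + 1 + 1) := by
      rw [show j + 1 + 1 + d = j + 1 + d + 1 by omega]; exact hk'.symm
    exact this
  exact h.ne (i := j + 1 + k) (j := j + 1 + d + 1) (by omega) (by omega) hk'.symm

theorem AvoidsRepetitions.eq_of_not_shortReturn (h : AvoidsRepetitions v d) (hd : 4 ≤ d)
    (hA : Fintype.card A = d) {j : ℕ} (hj : ¬ ShortReturn v d j)
    (hj' : ¬ ShortReturn v d (j + 1)) : v (j + 1 + d) = v (j + 1) := by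
  obtain ⟨k, hk, hk'⟩ := h.exists_eq hd hA hj (v (j + 1 + d))
  rcases Nat.eq_zero_or_pos k with rfl | hk0
  · exact hk'.symm
  exfalso
  by_cases h1 : k = 1
  · subst h1
    exact hj' hk'.symm
  exact h.ne (i := j + 1 + k) (j := j + 1 + d) (by omega) (by omega) hk'.symm

theorem AvoidsRepetitions.exists_shortReturn (h : AvoidsRepetitions v d) (hd : 4 ≤ d)
    (hA : Fintype.card A = d) (j : ℕ) :
    ShortReturn v d j ∨ ShortReturn v d (j + 1) ∨ ShortReturn v d (j + 2) := by
  by_contra! hc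
  obtain ⟨h0, h1, h2⟩ := hc
  have := h (j + 1) d 2 (by omega) (by
    intro k hk
    interval_cases k
    · exact h.eq_of_not_shortReturn hd hA h0 h1
    · exact h.eq_of_not_shortReturn hd hA h1 h2)
  omega

/-- If no repetition of exponent at least `(d - 1) / (d - 2)` occurs and the positions of short
returns are eventually periodic, a contradiction arises: the sequence is eventually periodic. -/
theorem AvoidsRepetitions.not_periodic_shortReturn (h : AvoidsRepetitions v d) (hd : 4 ≤ d)
    (hA : Fintype.card A = d) {N P : ℕ} (hN : 0 < N) (hP : 0 < P)
    (hper : ∀ n ≥ N, ShortReturn v d (n + P) ↔ ShortReturn v d n) : False := by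
  have hper' : ∀ c, ∀ n ≥ N, ShortReturn v d (n + c * P) ↔ ShortReturn v d n := by
    intro c
    induction c with
    | zero => simp
    | succ c ih =>
      intro n hn
      rw [show n + (c + 1) * P = n + c * P + P by ring, hper _ (by omega), ih n hn]
  -- Pigeonhole on windows of length `d + 1`: the recurrence looks back at most that far, so equal
  -- windows with equal swap patterns have equal continuations.
  obtain ⟨x, y, hxy, he⟩ := Finite.exists_ne_map_eq_of_infinite
    (fun (c : ℕ) (k : Fin (d + 1)) => v (N + c * P + k))
  wlog hlt : x < y generalizing x y
  · exact this y x hxy.symm he.symm (by omega)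
  obtain ⟨c, rfl⟩ : ∃ c, y = x + c := ⟨y - x, by omega⟩
  have hc : 0 < c := by omega
  set T := N + x * P with hT
  have hwin : ∀ k < d + 1, v (T + k + c * P) = v (T + k) := by
    intro k hk
    have := congrFun he ⟨k, hk⟩
    simp only at this
    rw [hT, this]
    congr 1
    ring
  have hall : ∀ k, v (T + k + c * P) = v (T + k) := by
    intro k
    induction k using Nat.strong_induction_on with
    | _ k ih =>
      rcases lt_or_ge k (d + 1) with hk | hk
      · exact hwin k hk
      obtain ⟨m, rfl⟩ : ∃ m, k = m + 1 + d := ⟨k - 1 - d, by omega⟩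
      have e0 := hper' c (T + m) (by omega)
      have e1 := hper' c (T + m + 1) (by omega)
      have i0 := ih m (by omega)
      have i1 := ih (m + 1) (by omega)
      have i2 := ih (m + 2) (by omega)
      rw [show T + m + 1 + c * P = T + m + c * P + 1 by omega] at e1
      have goal_l : T + (m + 1 + d) + c * P = T + m + c * P + 1 + d := by omega
      have goal_r : T + (m + 1 + d) = T + m + 1 + d := by omega
      rw [goal_l, goal_r]
      rw [show T + (m + 1) + c * P = T + m + c * P + 1 by omega,
        show T + (m + 1) = T + m + 1 by omega] at i1
      rw [show T + (m + 2) + c * P = T + m + c * P + 1 + 1 by omega,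
        show T + (m + 2) = T + m + 1 + 1 by omega] at i2
      by_cases s1 : ShortReturn v d (T + m + 1)
      · have s1' : v (T + m + c * P + 1 + d) = v (T + m + c * P + 1 + 1) := e1.2 s1
        have s1'' : v (T + m + 1 + d) = v (T + m + 1 + 1) := s1
        rw [s1', s1'', i2]
      by_cases s0 : ShortReturn v d (T + m)
      · obtain ⟨t, ht⟩ : ∃ t, T + m = t + 1 := ⟨T + m - 1, by omega⟩
        have s0' := e0.2 s0
        rw [ht] at s0
        rw [show T + m + c * P = t + c * P + 1 by omega] at s0'
        have r := h.eq_of_shortReturn hd hA s0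
        have r' := h.eq_of_shortReturn hd hA s0'
        rw [show T + m + c * P + 1 + d = t + c * P + 1 + d + 1 by omega, r',
          show T + m + 1 + d = t + 1 + d + 1 by omega, r,
          show t + c * P + 1 = T + m + c * P by omega, show t + 1 = T + m by omega]
        exact i0
      · have n0 : ¬ ShortReturn v d (T + m + c * P) := fun hh => s0 (e0.1 hh)
        have n1 : ¬ ShortReturn v d (T + m + c * P + 1) := fun hh => s1 (e1.1 hh)
        rw [h.eq_of_not_shortReturn hd hA n0 n1, h.eq_of_not_shortReturn hd hA s0 s1, i1]
  have := h T (c * P) (c * P) (Nat.mul_pos hc hP) (fun k _ => hall k)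
  have h2 : c * P * 1 ≤ c * P * (d - 2) := Nat.mul_le_mul_left _ (by omega)
  omega

theorem AvoidsRepetitions.eq_of_shortReturn_of_pos (h : AvoidsRepetitions v d) (hd : 4 ≤ d)
    (hA : Fintype.card A = d) {j : ℕ} (hj0 : 0 < j) (hj : ShortReturn v d j) :
    v (j + d + 1) = v j := by
  obtain ⟨t, rfl⟩ : ∃ t, j = t + 1 := ⟨j - 1, by omega⟩
  exact h.eq_of_shortReturn hd hA hj

/-- One direction suffices: if `n + P` is a swap, neither neighbour of `n` is one, as its shift
would be adjacent to `n + P`; so `n` is a swap. -/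
theorem AvoidsRepetitions.not_shortReturn_shift (h : AvoidsRepetitions v d) (hd : 4 ≤ d)
    (hA : Fintype.card A = d) {N P : ℕ} (hP : 0 < P)
    (hstep : ∀ j ≥ N, ShortReturn v d j → ShortReturn v d (j + P)) : False := by
  refine h.not_periodic_shortReturn hd hA (N := N + 1) (by omega) hP fun n hn =>
    ⟨fun hs => ?_, hstep n (by omega)⟩
  obtain ⟨t, rfl⟩ : ∃ t, n = t + 1 := ⟨n - 1, by omega⟩
  rcases h.exists_shortReturn hd hA t with h0 | h1 | h2
  · have := h.not_shortReturn_succ hd (hstep _ (by omega) h0)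
    rw [show t + P + 1 = t + 1 + P by omega] at this
    exact absurd hs this
  · exact h1
  · have := hstep _ (by omega) h2
    rw [show t + 2 + P = t + 1 + P + 1 by omega] at this
    exact absurd this (h.not_shortReturn_succ hd hs)

/-- The letter at position `n + 1` returns after exactly `d` positions. -/
def MediumReturn (v : ℕ → A) (d n : ℕ) : Prop :=
  ¬ ShortReturn v d n ∧ ¬ ShortReturn v d (n + 1)

theorem MediumReturn.shortReturn_neighbours {n : ℕ} (hn : MediumReturn v d (n + 1))
    (h : AvoidsRepetitions v d) (hd : 4 ≤ d) (hA : Fintype.card A = d) :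
    ShortReturn v d n ∧ ShortReturn v d (n + 3) := by
  have h1 := h.exists_shortReturn hd hA n
  have h2 := h.exists_shortReturn hd hA (n + 1)
  obtain ⟨a, b⟩ := hn
  exact ⟨by tauto, by tauto⟩

/-! ### Balance: propagation of swaps to the next row -/

variable [DecidableEq A]

/-- The letter made fast by the swap at `j` sits at `j + d`, where a swap would make it slow. -/
theorem IsBalanced.not_shortReturn_add (hv : IsBalanced v) (h : AvoidsRepetitions v d)
    (hd : 4 ≤ d) {j : ℕ} (hj0 : 0 < j) (hj : ShortReturn v d j) :
    ¬ ShortReturn v d (j + d) := fun hc =>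
  hv.not_isSlow_of_isFast h hd ⟨j, hj0, hj, rfl⟩ ⟨j + d, by omega, hc, hj⟩

theorem IsBalanced.shortReturn_of_add_two (hv : IsBalanced v) (h : AvoidsRepetitions v d)
    (hd : 4 ≤ d) (hA : Fintype.card A = d) {j : ℕ} (hj0 : 0 < j) (hj : ShortReturn v d j)
    (hj2 : ShortReturn v d (j + 2)) : ShortReturn v d (j + d + 1) := by
  have h0 := hv.not_shortReturn_add h hd hj0 hj
  have h2 := hv.not_shortReturn_add h hd (by omega) hj2
  rw [show j + 2 + d = j + d + 2 by omega] at h2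
  have := h.exists_shortReturn hd hA (j + d)
  tauto

theorem IsBalanced.shortReturn_of_add_three (hv : IsBalanced v) (h : AvoidsRepetitions v d)
    (hd : 4 ≤ d) (hA : Fintype.card A = d) {j : ℕ} (hj0 : 0 < j) (hj : ShortReturn v d j) :
    ShortReturn v d (j + d + 1) ∨ ShortReturn v d (j + d + 2) := by
  have h0 := hv.not_shortReturn_add h hd hj0 hj
  have := h.exists_shortReturn hd hA (j + d)
  tauto

theorem IsBalanced.mediumReturn_fast_or_slow (hv : IsBalanced v) (h : AvoidsRepetitions v d)
    (hd : 4 ≤ d) (hA : Fintype.card A = d) {j : ℕ} (hj : 0 < j)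
    (hn : MediumReturn v d (j + 1)) :
    (ShortReturn v d (j + d + 1) ∧ MediumReturn v d (j + d + 2) ∧ IsFast v d (v (j + 2)) ∧
        IsFast v d (v (j + d + 3))) ∨
      (ShortReturn v d (j + d + 2) ∧ MediumReturn v d (j + d) ∧ IsSlow v d (v (j + 2)) ∧
        IsSlow v d (v (j + d + 1))) := by
  obtain ⟨s0, s3⟩ := hn.shortReturn_neighbours h hd hA
  have n0 := hv.not_shortReturn_add h hd hj s0
  have n3 := hv.not_shortReturn_add h hd (by omega) s3
  rw [show j + 3 + d = j + d + 3 by omega] at n3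
  have hm : v (j + d + 2) = v (j + 2) := by
    have := h.eq_of_not_shortReturn hd hA hn.1 hn.2
    rwa [show j + 1 + 1 + d = j + d + 2 by omega] at this
  rcases hv.shortReturn_of_add_three h hd hA hj s0 with s | s
  · refine Or.inl ⟨s, ⟨h.not_shortReturn_succ hd s, n3⟩, ⟨_, by omega, s, hm⟩,
      ⟨j + 3, by omega, s3, ?_⟩⟩
    rw [show j + d + 3 = j + 3 + d by omega]
    exact Eq.symm s3
  · refine Or.inr ⟨s, ⟨n0, fun hc => h.not_shortReturn_succ hd hc s⟩, ⟨_, by omega, s, hm⟩,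
      ⟨j, hj, s0, (h.eq_of_shortReturn_of_pos hd hA hj s0).symm⟩⟩

theorem IsBalanced.fast_mediumReturn_step (hv : IsBalanced v) (h : AvoidsRepetitions v d)
    (hd : 4 ≤ d) (hA : Fintype.card A = d) {n : ℕ} (hn0 : 2 ≤ n)
    (hn : MediumReturn v d n) (hf : IsFast v d (v (n + 1))) :
    MediumReturn v d (n + d + 1) ∧ IsFast v d (v (n + d + 1 + 1)) := by
  obtain ⟨j, rfl⟩ : ∃ j, n = j + 1 := ⟨n - 1, by omega⟩
  rcases hv.mediumReturn_fast_or_slow h hd hA (by omega) hn with ⟨-, a, -, b⟩ | ⟨-, -, c, -⟩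
  · rw [show j + 1 + d + 1 = j + d + 2 by omega]
    exact ⟨a, b⟩
  · exact absurd c (hv.not_isSlow_of_isFast h hd hf)

theorem IsBalanced.slow_mediumReturn_step (hv : IsBalanced v) (h : AvoidsRepetitions v d)
    (hd : 4 ≤ d) (hA : Fintype.card A = d) {n : ℕ} (hn0 : 2 ≤ n)
    (hn : MediumReturn v d n) (hs : IsSlow v d (v (n + 1))) :
    MediumReturn v d (n + (d - 1)) ∧ IsSlow v d (v (n + (d - 1) + 1)) := by
  obtain ⟨j, rfl⟩ : ∃ j, n = j + 1 := ⟨n - 1, by omega⟩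
  rcases hv.mediumReturn_fast_or_slow h hd hA (by omega) hn with ⟨-, -, c, -⟩ | ⟨-, a, -, b⟩
  · exact absurd hs (hv.not_isSlow_of_isFast h hd c)
  · rw [show j + 1 + (d - 1) = j + d by omega]
    exact ⟨a, b⟩

/-- Going from one row of length `d` to the next, medium returns of fast letters move right and
those of slow letters move left, so the two kinds cannot coexist. -/
theorem IsBalanced.not_fast_le_slow (hv : IsBalanced v) (h : AvoidsRepetitions v d)
    (hd : 4 ≤ d) (hA : Fintype.card A = d) (g : ℕ) : ∀ n ≥ 2, MediumReturn v d n →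
      IsFast v d (v (n + 1)) → MediumReturn v d (n + g) → ¬ IsSlow v d (v (n + g + 1)) := by
  induction g using Nat.strong_induction_on with
  | _ g ih =>
    intro n hn2 hn hf hm hs
    obtain rfl | rfl | hg : g = 0 ∨ g = 1 ∨ 2 ≤ g := by omega
    · exact hv.not_isSlow_of_isFast h hd hf hs
    -- Adjacent medium returns would leave three consecutive positions without a swap.
    · have := h.exists_shortReturn hd hA n
      have h1 := hn.1
      have h2 := hn.2
      have h3 := hm.2
      tauto
    · obtain ⟨a, b⟩ := hv.fast_mediumReturn_step h hd hA hn2 hn hf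
      obtain ⟨a', b'⟩ := hv.slow_mediumReturn_step h hd hA (by omega) hm hs
      rw [show n + g + (d - 1) = n + d + 1 + (g - 2) by omega] at a' b'
      exact ih (g - 2) (by omega) _ (by omega) a b a' b'

theorem IsBalanced.not_fast_and_slow (hv : IsBalanced v) (h : AvoidsRepetitions v d)
    (hd : 4 ≤ d) (hA : Fintype.card A = d) {n m : ℕ} (hn2 : 2 ≤ n) (hn : MediumReturn v d n)
    (hf : IsFast v d (v (n + 1))) (hm2 : 2 ≤ m) (hm : MediumReturn v d m) :
    ¬ IsSlow v d (v (m + 1)) := by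
  intro hs
  -- Moving the slow medium return down `n` times brings it to the right of the fast one.
  have hiter : ∀ k, MediumReturn v d (m + k * (d - 1)) ∧
      IsSlow v d (v (m + k * (d - 1) + 1)) := by
    intro k
    induction k with
    | zero => simpa using ⟨hm, hs⟩
    | succ k ih =>
      rw [show m + (k + 1) * (d - 1) = m + k * (d - 1) + (d - 1) by ring]
      exact hv.slow_mediumReturn_step h hd hA (by omega) ih.1 ih.2
  obtain ⟨a, b⟩ := hiter n
  have hle : n * 1 ≤ n * (d - 1) := Nat.mul_le_mul_left _ (by omega)
  obtain ⟨g, hg⟩ : ∃ g, m + n * (d - 1) = n + g := ⟨m + n * (d - 1) - n, by omega⟩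
  rw [hg] at a b
  exact hv.not_fast_le_slow h hd hA g n hn2 hn hf a b

theorem IsBalanced.not_avoidsRepetitions (hv : IsBalanced v) (hd : 4 ≤ d)
    (hA : Fintype.card A = d) : ¬ AvoidsRepetitions v d := by
  intro h
  by_cases hslow : ∃ m ≥ 2, MediumReturn v d m ∧ IsSlow v d (v (m + 1))
  · obtain ⟨m, hm2, hm, hs⟩ := hslow
    refine h.not_shortReturn_shift hd hA (N := 4) (P := d - 1) (by omega) fun j hj hj' => ?_
    -- A shift by `d - 1` is read off the gap to the previous swap, which is at `t` or `t + 1`.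
    obtain ⟨t, rfl⟩ : ∃ t, j = t + 3 := ⟨j - 3, by omega⟩
    rcases h.exists_shortReturn hd hA t with h0 | h1 | h2
    · by_cases h1 : ShortReturn v d (t + 1)
      · exact absurd h1 (h.not_shortReturn_succ hd h0)
      by_cases h2 : ShortReturn v d (t + 2)
      · exact absurd hj' (h.not_shortReturn_succ hd h2)
      rcases hv.mediumReturn_fast_or_slow h hd hA (j := t) (by omega) ⟨h1, h2⟩ with
        ⟨-, -, hf, -⟩ | ⟨s, -⟩
      · exact absurd hs (hv.not_fast_and_slow h hd hA (by omega) ⟨h1, h2⟩ hf hm2 hm)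
      · rwa [show t + 3 + (d - 1) = t + d + 2 by omega]
    · have := hv.shortReturn_of_add_two h hd hA (by omega) h1 hj'
      rwa [show t + 3 + (d - 1) = t + 1 + d + 1 by omega]
    · exact absurd hj' (h.not_shortReturn_succ hd h2)
  · push Not at hslow
    refine h.not_shortReturn_shift hd hA (N := 1) (P := d + 1) (by omega) fun j hj hj' => ?_
    by_cases h1 : ShortReturn v d (j + 1)
    · exact absurd h1 (h.not_shortReturn_succ hd hj')
    by_cases h2 : ShortReturn v d (j + 2)
    · exact hv.shortReturn_of_add_two h hd hA (by omega) hj' h2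
    rcases hv.mediumReturn_fast_or_slow h hd hA (j := j) (by omega) ⟨h1, h2⟩ with
      ⟨s, -⟩ | ⟨-, -, hs, -⟩
    · exact s
    · exact absurd hs (hslow _ (by omega) ⟨h1, h2⟩)

end Swaps

end WordSeq

theorem theorem3p2 (d : ℕ) (hd : 11 ≤ d) (A : Type*) [Fintype A] [DecidableEq A]
    (hA : Fintype.card A = d) :
    ¬ ∃ v : ℕ → A, WordSeq.IsBalanced v ∧
      WordSeq.criticalExponent v < ((((d : ℝ) - 1) / ((d : ℝ) - 2) : ℝ) : EReal) := by
  rintro ⟨v, hv, hE⟩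
  exact hv.not_avoidsRepetitions (by omega) hA fun s p q hp h =>
    WordSeq.mul_lt_of_criticalExponent_lt (by omega) hE hp h
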